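/- Let $k$ be a field, let $m\ge 1$ be an integer, let $B$ be a finite-dimensional $k$-algebra of global dimension $m+1$, and let $M$ be a finitely generated left $B$-module. Let $$A=B[M]=\begin{pmatrix} B & M\\ 0 & k\end{pmatrix}$$ be the one-point extension of $B$ by $M$, that is, the $k$-algebra of matrices $\begin{pmatrix} b & x\\ 0 & c\end{pmatrix}$ with $b\in B$, $x\in M$, $c\in k$, under the usual matrix operations (where $x\cdot c:=cx$). For positive integers $m,n$, a finite-dimensional $k$-algebra $C$ is called $(m,n)$-almost hereditary if its global dimension equals $m+n$ and every indecomposable finitely generated left $C$-module $X$ satisfies $\operatorname{pd}_C X\le m$ or $\operatorname{id}_C X\le n$ (or both), where $\operatorname{pd}$ and $\operatorname{id}$ denote the projective and injective dimension. If $A$ is $(m,1)$-almost hereditary, then $B$ is $(m,1)$-almost hereditary. -/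

import Mathlib

universe u

/-- The one-point extension `B[M]` of a `k`-algebra `B` by a left `B`-module `M`: the algebra of
triangular matrices `[[b, m], [0, c]]` with `b ∈ B`, `m ∈ M`, `c ∈ k`, with matrix addition and
multiplication. The scalars `c ∈ k` act on `M` from the right through its `k`-module structure. -/
@[ext]
structure OnePointExtension (k B M : Type u) : Type u where
  /-- the upper left entry -/
  topLeft : B
  /-- the upper right entry -/
  topRight : M
  /-- the lower right entry -/
  botRight : k

namespace OnePointExtension

variable {k B M : Type u} [Field k] [Ring B] [AddCommGroup M]

instance : Zero (OnePointExtension k B M) := ⟨⟨0, 0, 0⟩⟩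
instance : One (OnePointExtension k B M) := ⟨⟨1, 0, 1⟩⟩
instance : Add (OnePointExtension k B M) :=
  ⟨fun x y => ⟨x.topLeft + y.topLeft, x.topRight + y.topRight, x.botRight + y.botRight⟩⟩
instance : Neg (OnePointExtension k B M) := ⟨fun x => ⟨-x.topLeft, -x.topRight, -x.botRight⟩⟩

@[simp] theorem zero_topLeft : (0 : OnePointExtension k B M).topLeft = 0 := rfl
@[simp] theorem zero_topRight : (0 : OnePointExtension k B M).topRight = 0 := rfl
@[simp] theorem zero_botRight : (0 : OnePointExtension k B M).botRight = 0 := rfl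
@[simp] theorem one_topLeft : (1 : OnePointExtension k B M).topLeft = 1 := rfl
@[simp] theorem one_topRight : (1 : OnePointExtension k B M).topRight = 0 := rfl
@[simp] theorem one_botRight : (1 : OnePointExtension k B M).botRight = 1 := rfl
@[simp] theorem add_topLeft (x y : OnePointExtension k B M) :
    (x + y).topLeft = x.topLeft + y.topLeft := rfl
@[simp] theorem add_topRight (x y : OnePointExtension k B M) :
    (x + y).topRight = x.topRight + y.topRight := rfl
@[simp] theorem add_botRight (x y : OnePointExtension k B M) :
    (x + y).botRight = x.botRight + y.botRight := rfl
@[simp] theorem neg_topLeft (x : OnePointExtension k B M) : (-x).topLeft = -x.topLeft := rfl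
@[simp] theorem neg_topRight (x : OnePointExtension k B M) : (-x).topRight = -x.topRight := rfl
@[simp] theorem neg_botRight (x : OnePointExtension k B M) : (-x).botRight = -x.botRight := rfl

variable [Module k M] [Module B M]

instance : Mul (OnePointExtension k B M) :=
  ⟨fun x y => ⟨x.topLeft * y.topLeft, x.topLeft • y.topRight + y.botRight • x.topRight,
    x.botRight * y.botRight⟩⟩

@[simp] theorem mul_topLeft (x y : OnePointExtension k B M) :
    (x * y).topLeft = x.topLeft * y.topLeft := rfl
@[simp] theorem mul_topRight (x y : OnePointExtension k B M) :
    (x * y).topRight = x.topLeft • y.topRight + y.botRight • x.topRight := rfl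
@[simp] theorem mul_botRight (x y : OnePointExtension k B M) :
    (x * y).botRight = x.botRight * y.botRight := rfl

variable [Algebra k B] [IsScalarTower k B M]

instance : Ring (OnePointExtension k B M) where
  add_assoc x y z := by ext <;> simp [add_assoc]
  zero_add x := by ext <;> simp
  add_zero x := by ext <;> simp
  add_comm x y := by ext <;> simp [add_comm]
  neg_add_cancel x := by ext <;> simp
  left_distrib x y z := by
    ext
    · simp [mul_add]
    · simp only [mul_topRight, add_topRight, add_botRight, smul_add, add_smul]
      abel
    · simp [mul_add]
  right_distrib x y z := by
    ext
    · simp [add_mul]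
    · simp only [mul_topRight, add_topRight, add_topLeft, smul_add, add_smul]
      abel
    · simp [add_mul]
  zero_mul x := by ext <;> simp
  mul_zero x := by ext <;> simp
  mul_assoc x y z := by
    ext
    · simp [mul_assoc]
    · have h : z.botRight • x.topLeft • y.topRight = x.topLeft • z.botRight • y.topRight := by
        rw [← algebraMap_smul B z.botRight (x.topLeft • y.topRight),
          ← algebraMap_smul B z.botRight y.topRight, smul_smul, smul_smul, Algebra.commutes]
      simp only [mul_topRight, mul_topLeft, mul_botRight, smul_add, mul_smul, h]
      rw [smul_comm y.botRight z.botRight x.topRight, add_assoc]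
    · simp [mul_assoc]
  one_mul x := by ext <;> simp
  mul_one x := by ext <;> simp
  nsmul := nsmulRec
  zsmul := zsmulRec

/-- `k` acts through the diagonal matrices. -/
instance : Algebra k (OnePointExtension k B M) :=
  RingHom.toAlgebra'
    { toFun := fun c => ⟨algebraMap k B c, 0, c⟩
      map_one' := by ext <;> simp
      map_mul' := fun c d => by ext <;> simp
      map_zero' := by ext <;> simp
      map_add' := fun c d => by ext <;> simp }
    (fun c x => by
      ext
      · exact Algebra.commutes c x.topLeft
      · change algebraMap k B c • x.topRight + x.botRight • (0 : M)
          = x.topLeft • (0 : M) + c • x.topRight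
        simp
      · exact mul_comm c x.botRight)

end OnePointExtension

/-- The (left) global dimension of a ring: the supremum of the projective dimensions of its left
modules. -/
noncomputable def globalDimension (A : Type u) [Ring A] : WithBot ℕ∞ :=
  ⨆ X : ModuleCat.{u} A, CategoryTheory.projectiveDimension X

/-- `(m, n)`-almost hereditary algebras, for positive integers `m`, `n`: the global dimension is
`m + n`, and each indecomposable finitely generated left module has projective dimension at most
`m` or injective dimension at most `n`. -/
structure IsAlmostHereditary (m n : ℕ) (A : Type u) [Ring A] : Prop where
  left_pos : 0 < m
  right_pos : 0 < n
  globalDimension_eq : globalDimension A = ((m + n : ℕ) : WithBot ℕ∞)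
  projectiveDimension_le_or_injectiveDimension_le :
    ∀ X : ModuleCat.{u} A, Module.Finite A X → CategoryTheory.Indecomposable X →
      CategoryTheory.projectiveDimension X ≤ (m : WithBot ℕ∞) ∨
        CategoryTheory.injectiveDimension X ≤ (n : WithBot ℕ∞)

open CategoryTheory CategoryTheory.Limits

namespace CategoryTheory.Adjunction

universe v₁ v₂ u₁ u₂

variable {C : Type u₁} {D : Type u₂} [Category.{v₁} C] [Category.{v₂} D] [Abelian C] [Abelian D]
  {F : C ⥤ D} {G : D ⥤ C}

/-! Let `F` be restriction along the surjection of `A = B[M]` onto its corner `B`, and `G = Hom_A(B,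
-)` its right adjoint. `F` is exact and fully faithful, so `G F X ≅ X`. As a left `A`-module `B` is
the first column `A e`, hence projective, so `G` is exact and `F` preserves projectives. Therefore
`pd_B X ≤ pd_A (F X)`, `id_B X = id_B (G F X) ≤ id_A (F X)`, and `F X` is indecomposable when `X`
is, so the dichotomy over `A` descends to `B`. -/

/-- A fully faithful exact functor that preserves projective objects reflects upper bounds on the
projective dimension. -/
theorem _root_.CategoryTheory.Functor.hasProjectiveDimensionLT_of_map [EnoughProjectives C]
    (F : C ⥤ D) [F.Full] [F.Faithful] [F.Additive] [PreservesFiniteLimits F]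
    [PreservesFiniteColimits F] [F.PreservesProjectiveObjects] (n : ℕ) :
    ∀ X : C, HasProjectiveDimensionLT (F.obj X) n → HasProjectiveDimensionLT X n := by
  induction n with
  | zero =>
    intro X h
    rw [hasProjectiveDimensionLT_zero_iff_isZero, IsZero.iff_id_eq_zero] at h ⊢
    exact F.map_injective (by rw [F.map_id, h, F.map_zero])
  | succ n ih =>
    intro X h
    -- Dimension shifting compares bound `n + 2` on the quotient with bound `n + 1` on the kernel,
    -- so the projective case (bound `1`) is settled separately.
    obtain rfl | n := n
    · rw [← projective_iff_hasProjectiveDimensionLT_one] at h ⊢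
      exact F.projective_of_map_projective h
    · let S : ShortComplex C := ShortComplex.mk _ _ (kernel.condition (Projective.π X))
      have hS : S.ShortExact := { exact := ShortComplex.exact_kernel _ }
      have h₂ : Projective S.X₂ := inferInstanceAs (Projective (Projective.over X))
      have hF₂ : Projective (S.map F).X₂ := F.projective_obj_of_projective h₂
      rw [← show S.X₃ = X from rfl, hS.hasProjectiveDimensionLT_X₃_iff n h₂]
      exact ih _ (((hS.map_of_exact F).hasProjectiveDimensionLT_X₃_iff n hF₂).1 h)

/-- The exact right adjoint of an exact functor does not increase the injective dimension. -/
theorem hasInjectiveDimensionLT_map [EnoughInjectives D] (adj : F ⊣ G) [G.Additive]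
    [F.PreservesMonomorphisms] [G.PreservesEpimorphisms] (n : ℕ) :
    ∀ Y : D, HasInjectiveDimensionLT Y n → HasInjectiveDimensionLT (G.obj Y) n := by
  have : PreservesLimitsOfSize.{0, 0} G := adj.rightAdjoint_preservesLimits
  induction n with
  | zero =>
    intro Y h
    rw [hasInjectiveDimensionLT_zero_iff_isZero] at h ⊢
    exact G.map_isZero h
  | succ n ih =>
    intro Y h
    obtain rfl | n := n
    · rw [← injective_iff_hasInjectiveDimensionLT_one] at h ⊢
      exact adj.map_injective _ h
    · let S : ShortComplex D := ShortComplex.mk _ _ (cokernel.condition (Injective.ι Y))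
      have hS : S.ShortExact := { exact := ShortComplex.exact_cokernel _ }
      have hGS : (S.map G).ShortExact :=
        -- Left exactness is automatic for a right adjoint; only the final epimorphism uses the
        -- hypothesis on `G`.
        have hG := ((Functor.preservesFiniteLimits_tfae G).out 3 0 rfl rfl).1
          (inferInstance : PreservesFiniteLimits G) S hS
        have := hS.epi_g
        { exact := hG.1
          mono_f := hG.2
          epi_g := inferInstanceAs (Epi (G.map S.g)) }
      have h₂ : Injective S.X₂ := inferInstanceAs (Injective (Injective.under Y))
      have hG₂ : Injective (S.map G).X₂ := adj.map_injective _ h₂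
      exact (hGS.hasInjectiveDimensionLT_X₃_iff n hG₂).1
        (ih _ ((hS.hasInjectiveDimensionLT_X₃_iff n h₂).2 h))

/-- A fully faithful exact functor with an exact right adjoint reflects upper bounds on the
injective dimension. -/
theorem hasInjectiveDimensionLT_of_map [EnoughInjectives D] (adj : F ⊣ G) [F.Full] [F.Faithful]
    [G.Additive] [F.PreservesMonomorphisms] [G.PreservesEpimorphisms] (n : ℕ) (X : C)
    (h : HasInjectiveDimensionLT (F.obj X) n) : HasInjectiveDimensionLT X n :=
  have : HasInjectiveDimensionLT ((F ⋙ G).obj X) n := adj.hasInjectiveDimensionLT_map n _ h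
  hasInjectiveDimensionLT_of_iso (asIso (adj.unit.app X)).symm n

/-- A fully faithful left adjoint with an additive right adjoint preserves indecomposability. -/
theorem indecomposable_map (adj : F ⊣ G) [F.Full] [F.Faithful] [F.Additive] [G.Additive] {X : C}
    (hX : Indecomposable X) : Indecomposable (F.obj X) := by
  -- `G` may kill nonzero objects, but not nonzero quotients of `F X`: the counit at `F X` is
  -- invertible, so by naturality the counit at `Y` is epi, and its source `F G Y` vanishes.
  have isZero_of_epi {Y : D} (p : F.obj X ⟶ Y) [Epi p] (hY : IsZero (G.obj Y)) : IsZero Y := by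
    have hc : Epi (F.map (G.map p) ≫ adj.counit.app Y) := by
      rw [show F.map (G.map p) ≫ adj.counit.app Y = adj.counit.app (F.obj X) ≫ p from
        adj.counit.naturality p]
      infer_instance
    have : Epi (adj.counit.app Y) := epi_of_epi (F.map (G.map p)) _
    exact (F.map_isZero hY).of_epi (adj.counit.app Y)
  refine ⟨fun h => hX.1 ((G.map_isZero h).of_iso (asIso (adj.unit.app X))), fun Y Z e => ?_⟩
  have : PreservesBinaryBiproduct Y Z G := preservesBinaryBiproduct_of_preservesBiproduct G Y Z
  let e' : X ≅ G.obj Y ⊞ G.obj Z :=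
    asIso (adj.unit.app X) ≪≫ G.mapIso e ≪≫ G.mapBiprod Y Z
  exact (hX.2 _ _ e').imp (isZero_of_epi (e.hom ≫ biprod.fst)) (isZero_of_epi (e.hom ≫ biprod.snd))

end CategoryTheory.Adjunction

namespace ModuleCat

universe v u₁ u₂

theorem restrictScalars_full_of_surjective {R : Type u₁} {S : Type u₂} [Ring R] [Ring S]
    {f : R →+* S} (hf : Function.Surjective f) : (restrictScalars.{v} f).Full where
  map_surjective {X Y} g := by
    refine ⟨ofHom { toFun := g.hom, map_add' := g.hom.map_add, map_smul' := fun s x => ?_ }, rfl⟩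
    obtain ⟨r, rfl⟩ := hf s
    exact g.hom.map_smul r x

/-- Coextension is `Hom_R(S, -)`, so this is the lifting property of `S` as an `R`-module. -/
theorem coextendScalars_preservesEpimorphisms {R S : Type u} [Ring R] [Ring S] (f : R →+* S)
    [Module.Projective R ((restrictScalars f).obj (of S S))] :
    (coextendScalars.{u, u, u} f).PreservesEpimorphisms where
  preserves {M N} g hg := by
    rw [epi_iff_surjective] at hg ⊢
    intro h
    obtain ⟨l, hl⟩ := Module.projective_lifting_property g.hom (CoextendScalars.equiv f N h) hg
    exact ⟨(CoextendScalars.equiv f M).symm l, CoextendScalars.ext hl⟩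

end ModuleCat

namespace OnePointExtension

variable {k B M : Type u} [Field k] [Ring B] [AddCommGroup M] [Module k M] [Module B M]
  [Algebra k B] [IsScalarTower k B M]

/-- The projection of the one-point extension onto its upper left corner. -/
def topLeftHom : OnePointExtension k B M →+* B where
  toFun := topLeft
  map_one' := rfl
  map_mul' _ _ := rfl
  map_zero' := rfl
  map_add' _ _ := rfl

theorem topLeftHom_surjective : Function.Surjective (topLeftHom (k := k) (B := B) (M := M)) :=
  fun b => ⟨⟨b, 0, 0⟩, rfl⟩

/-- The first column is a direct summand of the regular module: its entries in `M` and `k` are zero,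
so it is a copy of `B`. -/
instance projective_restrictScalars_topLeftHom :
    Module.Projective (OnePointExtension k B M)
      ((ModuleCat.restrictScalars (topLeftHom (k := k) (B := B) (M := M))).obj
        (ModuleCat.of B B)) := by
  let i : ((ModuleCat.restrictScalars (topLeftHom (k := k) (B := B) (M := M))).obj
      (ModuleCat.of B B)) →ₗ[OnePointExtension k B M] OnePointExtension k B M :=
    { toFun := fun b : B => ⟨b, 0, 0⟩
      map_add' := fun b c => by ext <;> simp; rfl
      map_smul' := fun a b => by ext <;> simp; rfl }
  let p : OnePointExtension k B M →ₗ[OnePointExtension k B M]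
      ((ModuleCat.restrictScalars (topLeftHom (k := k) (B := B) (M := M))).obj
        (ModuleCat.of B B)) :=
    { toFun := topLeft
      map_add' := fun _ _ => rfl
      map_smul' := fun _ _ => rfl }
  exact Module.Projective.of_split i p rfl

end OnePointExtension

theorem mainTheorem9 (k B M : Type u) [Field k] [Ring B] [Algebra k B] [FiniteDimensional k B]
    [AddCommGroup M] [Module k M] [Module B M] [IsScalarTower k B M] [Module.Finite B M]
    (m : ℕ) (hB : globalDimension B = ((m + 1 : ℕ) : WithBot ℕ∞))
    (hA : IsAlmostHereditary m 1 (OnePointExtension k B M)) :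
    IsAlmostHereditary m 1 B := by
  let f : OnePointExtension k B M →+* B := OnePointExtension.topLeftHom
  let F := ModuleCat.restrictScalars.{u} f
  have hf : Function.Surjective f := OnePointExtension.topLeftHom_surjective
  have : F.Full := ModuleCat.restrictScalars_full_of_surjective hf
  have : F.Faithful := inferInstanceAs (ModuleCat.restrictScalars f).Faithful
  have : F.Additive := inferInstanceAs (ModuleCat.restrictScalars f).Additive
  have : F.PreservesMonomorphisms :=
    inferInstanceAs (ModuleCat.restrictScalars f).PreservesMonomorphisms
  have : PreservesFiniteLimits F := 
    ⟨fun _ _ _ => ⟨fun {_} => ModuleCat.preservesLimit_restrictScalars f _⟩⟩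
  have adj : F ⊣ ModuleCat.coextendScalars f := ModuleCat.restrictCoextendScalarsAdj f
  have : PreservesColimitsOfSize.{0, 0} F := adj.leftAdjoint_preservesColimits
  have : (ModuleCat.coextendScalars.{u, u, u} f).Additive := adj.right_adjoint_additive
  have : (ModuleCat.coextendScalars.{u, u, u} f).PreservesEpimorphisms :=
    have := OnePointExtension.projective_restrictScalars_topLeftHom (k := k) (B := B) (M := M)
    ModuleCat.coextendScalars_preservesEpimorphisms f
  have : F.PreservesProjectiveObjects :=
    Functor.preservesProjectiveObjects_of_adjunction_of_preservesEpimorphisms adj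
  refine ⟨hA.left_pos, hA.right_pos, hB, fun X hX hX' => ?_⟩
  have hFX : Module.Finite (OnePointExtension k B M) (F.obj X) := by
    -- The same generators work, since every scalar of `B` lifts along `f`.
    obtain ⟨s, hs⟩ := hX
    refine ⟨s, eq_top_iff.2 fun (x : X) _ => ?_⟩
    have hx : x ∈ Submodule.span B (s : Set X) := hs ▸ Submodule.mem_top
    induction hx using Submodule.span_induction with
    | mem x h => exact Submodule.subset_span h
    | zero => exact Submodule.zero_mem _
    | add x y _ _ hx hy => exact Submodule.add_mem _ (hx trivial) (hy trivial)
    | smul b x _ hx =>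
      obtain ⟨a, rfl⟩ := hf b
      exact Submodule.smul_mem _ a (hx trivial)
  refine (hA.projectiveDimension_le_or_injectiveDimension_le (F.obj X) hFX
    (adj.indecomposable_map hX')).imp (fun h => ?_) fun h => ?_
  · rw [projectiveDimension_le_iff] at h ⊢
    exact F.hasProjectiveDimensionLT_of_map _ X h
  · rw [injectiveDimension_le_iff] at h ⊢
    exact adj.hasInjectiveDimensionLT_of_map _ X h
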